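/- Fix an additively optimal (universal) machine $U$ and let $C(x\mid n)$ be the plain conditional Kolmogorov complexity with respect to $U$, i.e. the length of a shortest binary program from which $U$, given the number $n$, outputs the binary string $x$. A labelled graph $G$ on the vertices $1,\dots,n$ is encoded by the string $E(G)$ of length $\binom n2$ whose bits tell which of the pairs $i<j$, in lexicographic order, are edges. For $\delta:\mathbb N\to\mathbb R$, the graph $G$ is called $\delta(n)$-random if $C(E(G)\mid n)\ge \binom n2-\delta(n)$. A family of labelled graphs is size constructible (with vertex ordering information) if there is an algorithm that constructs each graph of the family from its number of vertices and a suitable permutation of the vertices. The induced Ramsey number $r_{\mathrm{ind}}(H)$ is the least $n$ for which there is a graph $G$ on $n$ vertices such that every 2-colouring of the edges of $G$ contains an induced monochromatic copy of $H$; the number $r^{\mathrm{INC},\delta(n)}_{\mathrm{ind}}(H)$ is the least $n$ for which there is such a graph $G$ on $n$ vertices that is moreover $\delta(n)$-random. **Theorem.** Let $H$ be a labelled graph on $k$ vertices, of maximum degree at most $d$, that belongs to a size constructible family (with vertex ordering information). Put $n_1=\lfloor 2^{(k-1)/2}-1\rfloor$ (read as $0$ if $k=0$) and $n_2=r_{\mathrm{ind}}(H)$,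 and let $\delta:\mathbb N\to\mathbb R$ satisfy $\delta(n)\ge n_1n_2+\binom{n_2}{2}$ for $n=n_1+n_2$. Then (i) $r^{\mathrm{INC},\delta(n)}_{\mathrm{ind}}(H)$ exists, i.e. some $\delta(n)$-random graph on some number $n$ of vertices is such that every 2-colouring of its edges contains an induced monochromatic copy of $H$; and (ii) $r^{\mathrm{INC},\delta(n)}_{\mathrm{ind}}(H)<2^{(k-1)/2}+r_{\mathrm{ind}}(H)$. -/

import Mathlib

/-! ### Conditional Kolmogorov complexity -/

/-- `U` is an additively optimal (universal) reference machine for plain conditional Kolmogorov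
complexity. A machine receives a binary program together with the number on which the complexity is
conditioned, and outputs a binary string if it halts. `U` is optimal if it is partial recursive and
simulates every partial recursive machine `V` with programs longer by at most an additive constant
depending only on `V`. -/
def IsReferenceMachine (U : List Bool × ℕ →. List Bool) : Prop :=
  Partrec U ∧ ∀ V : List Bool × ℕ →. List Bool, Partrec V →
    ∃ c : ℕ, ∀ (n : ℕ) (p x : List Bool), x ∈ V (p, n) →
      ∃ q : List Bool, x ∈ U (q, n) ∧ q.length ≤ p.length + c

/-- The conditional Kolmogorov complexity `C(x | n)` with respect to the machine `U`: the length of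
a shortest program that outputs `x` when `n` is given. (For a reference machine such a program
exists for every `x` and `n`.) -/
noncomputable def condComplexity (U : List Bool × ℕ →. List Bool) (x : List Bool) (n : ℕ) : ℕ :=
  sInf {l : ℕ | ∃ p : List Bool, x ∈ U (p, n) ∧ p.length = l}

/-- Over a reference machine every string has a program, so that the minimum above is attained. -/
theorem exists_program {U : List Bool × ℕ →. List Bool} (hU : IsReferenceMachine U)
    (x : List Bool) (n : ℕ) :
    ∃ p : List Bool, x ∈ U (p, n) ∧ p.length = condComplexity U x n := by
  obtain ⟨c, hc⟩ := hU.2 (fun a => Part.some a.1) Computable.fst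
  obtain ⟨q, hq, -⟩ := hc n x x (Part.mem_some x)
  exact Nat.sInf_mem (s := {l : ℕ | ∃ p : List Bool, x ∈ U (p, n) ∧ p.length = l}) ⟨_, q, hq, rfl⟩

/-- Reference machines exist: on a program `1^e 0 p`, run the `e`-th partial recursive function
on `p` and the condition. -/
theorem exists_isReferenceMachine : ∃ U, IsReferenceMachine U := by
  let e : List Bool → ℕ := fun w => (w.takeWhile id).length
  let r : List Bool → List Bool := fun w => (w.dropWhile id).tail
  refine ⟨fun a => (Nat.Partrec.Code.eval (Denumerable.ofNat Nat.Partrec.Code (e a.1))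
    (Encodable.encode (r a.1, a.2))).bind
      (fun m => ((Encodable.decode m : Option (List Bool)) : Part (List Bool))), ?_, ?_⟩
  · have he : Primrec e := Primrec.list_length.comp (Primrec.list_takeWhile Primrec.id)
    have hr : Primrec r := Primrec.list_tail.comp (Primrec.list_dropWhile Primrec.id)
    refine Partrec.bind (Nat.Partrec.Code.eval_part.comp ?_ ?_) ?_
    · exact ((Primrec.ofNat Nat.Partrec.Code).comp (he.comp Primrec.fst)).to_comp
    · exact (Primrec.encode.comp (Primrec.pair (hr.comp Primrec.fst) Primrec.snd)).to_comp
    · exact (Computable.decode.comp Computable.snd).ofOption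
  · intro V hV
    obtain ⟨cd, hcd⟩ := Nat.Partrec.Code.exists_code.1 hV
    refine ⟨Encodable.encode cd + 1, fun n p x hx => ?_⟩
    refine ⟨List.replicate (Encodable.encode cd) true ++ false :: p, ?_, ?_⟩
    · have h1 : e (List.replicate (Encodable.encode cd) true ++ false :: p)
          = Encodable.encode cd := by
        simp [e]
      have h2 : r (List.replicate (Encodable.encode cd) true ++ false :: p) = p := by
        simp [r]
      simp only [h1, h2, Denumerable.ofNat_encode, hcd]
      simpa using hx
    · simp; omega

/-! ### Labelled graphs as binary strings, and random graphs -/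

open Classical in
/-- The standard encoding `E(G)` of a labelled graph on `n` nodes as a binary string of length
`n.choose 2`: its bits tell which of the pairs `i < j`, in lexicographic order, are edges. -/
noncomputable def graphCode {n : ℕ} (G : SimpleGraph (Fin n)) : List Bool :=
  (List.finRange n).flatMap fun i =>
    ((List.finRange n).filter fun j => decide (i < j)).map fun j => decide (G.Adj i j)

/-- A labelled graph `G` on `n` nodes is `δ(n)`-random (has randomness deficiency at most `δ(n)`)
if `C(E(G) | n) ≥ n.choose 2 - δ(n)`. -/
def IsRandomGraph (U : List Bool × ℕ →. List Bool) (δ : ℕ → ℝ) {n : ℕ}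
    (G : SimpleGraph (Fin n)) : Prop :=
  (n.choose 2 : ℝ) - δ n ≤ (condComplexity U (graphCode G) n : ℝ)

/-! ### Size constructible families -/

/-- A family `F` of labelled graphs (`F k` being its members on `k` vertices) is size constructible,
with vertex ordering information, if there is an algorithm that constructs each member of the family
from its number `k` of vertices and a permutation of the vertices (given as the list of its
values). -/
def SizeConstructible (F : (k : ℕ) → Set (SimpleGraph (Fin k))) : Prop :=
  ∃ P : ℕ × List ℕ →. List Bool, Partrec P ∧
    ∀ (k : ℕ), ∀ G ∈ F k, ∃ σ : Equiv.Perm (Fin k),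
      graphCode G ∈ P (k, List.ofFn fun i => (σ i : ℕ))

/-! ### Induced Ramsey numbers -/

/-- Every 2-colouring of the edges of `G` contains an induced monochromatic copy of `H`. -/
def InducedArrows {V W : Type*} (G : SimpleGraph V) (H : SimpleGraph W) : Prop :=
  ∀ c : G.edgeSet → Fin 2, ∃ (f : H ↪g G) (a : Fin 2), ∀ e : H.edgeSet, c (f.mapEdgeSet e) = a

/-- The numbers `n` of vertices of the graphs all of whose edge 2-colourings contain an induced
monochromatic copy of `H`. -/
def inducedRamseyOrders {W : Type*} (H : SimpleGraph W) : Set ℕ :=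
  {n | ∃ G : SimpleGraph (Fin n), InducedArrows G H}

/-- The induced Ramsey number `r_ind(H)`. -/
noncomputable def inducedRamseyNumber {W : Type*} (H : SimpleGraph W) : ℕ :=
  sInf (inducedRamseyOrders H)

/-- The numbers `n` of vertices of the `δ(n)`-random graphs all of whose edge 2-colourings contain
an induced monochromatic copy of `H`. -/
def randomInducedRamseyOrders (U : List Bool × ℕ →. List Bool) (δ : ℕ → ℝ) {W : Type*}
    (H : SimpleGraph W) : Set ℕ :=
  {n | ∃ G : SimpleGraph (Fin n), IsRandomGraph U δ G ∧ InducedArrows G H}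

/-- The induced Ramsey number of `H` restricted to `δ(n)`-random graphs; it exists when the set of
which it is the minimum is nonempty. -/
noncomputable def randomInducedRamseyNumber (U : List Bool × ℕ →. List Bool) (δ : ℕ → ℝ)
    {W : Type*} (H : SimpleGraph W) : ℕ :=
  sInf (randomInducedRamseyOrders U δ H)

/-! Take `G` on `n₂` vertices attaining the induced Ramsey number and add a disjoint graph `K` on
`n₁` vertices. The union keeps `G` as an induced subgraph, so it still arrows `H`. Distinct `K` give
distinct codes and there are at least `2 ^ n₁.choose 2` of them, so some union has complexity at
least `n₁.choose 2`, which is random enough for `δ`.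

That `G` exists is the induced Ramsey theorem. Copies of `H` are spread over many parts in all
injective ways. Hales–Jewett, applied to one pair of parts after another
(`exists_partite_mono_pairs`), makes colours depend only on the parts. Ramsey's theorem on the parts
then selects a monochromatic copy. -/

/-! ### Ramsey's theorem for pairs -/

/-- Ramsey's theorem for two colours: a large enough set of vertices contains a clique of size `s`
or an independent set of size `t`. -/
theorem exists_ramsey_bound {V : Type*} (G : SimpleGraph V) (s t : ℕ) :
    ∀ S : Finset V, 2 ^ (s + t) ≤ S.card →
      (∃ T ⊆ S, T.card = s ∧ G.IsClique T) ∨ (∃ T ⊆ S, T.card = t ∧ Gᶜ.IsClique T) := by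
  classical
  obtain ⟨m, hm⟩ : ∃ m, m = s + t := ⟨_, rfl⟩
  induction m generalizing s t with
  | zero =>
    intro S _
    exact Or.inl ⟨∅, by simp, by simp; omega, by simp⟩
  | succ m ih =>
    intro S hS
    rcases s with _ | s
    · exact Or.inl ⟨∅, by simp, by simp, by simp⟩
    rcases t with _ | t
    · exact Or.inr ⟨∅, by simp, by simp, by simp⟩
    have hpos : 0 < S.card := lt_of_lt_of_le (by positivity) hS
    obtain ⟨v, hv⟩ := Finset.card_pos.1 hpos
    have hsplit := Finset.card_filter_add_card_filter_not (s := S.erase v) (fun w => G.Adj v w)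
    rw [Finset.card_erase_of_mem hv] at hsplit
    have h2 : 2 ^ (s + 1 + (t + 1)) = 2 * 2 ^ (s + t + 1) := by ring
    have extend : ∀ (K : SimpleGraph V) (T : Finset V) (j : ℕ), T ⊆ S.erase v →
        (∀ w ∈ T, K.Adj v w) → T.card = j → K.IsClique T →
        ∃ T' ⊆ S, T'.card = j + 1 ∧ K.IsClique T' := by
      intro K T j hT hadj hcard hcl
      refine ⟨insert v T, ?_, ?_, ?_⟩
      · exact Finset.insert_subset hv (hT.trans (Finset.erase_subset _ _))
      · rw [Finset.card_insert_of_notMem, hcard]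
        exact fun h => Finset.notMem_erase v S (hT h)
      · rw [Finset.coe_insert, SimpleGraph.isClique_insert]
        exact ⟨hcl, fun w hw _ => hadj w hw⟩
    -- Without `v` at least `2 * 2 ^ (s + t + 1) - 1` vertices remain, so neighbours or
    -- non-neighbours number at least `2 ^ (s + t + 1)`.
    rcases Nat.lt_or_ge ((S.erase v).filter fun w => G.Adj v w).card (2 ^ (s + t + 1)) with h | h
    · have h' : 2 ^ (s + 1 + t) ≤ ((S.erase v).filter fun w => ¬ G.Adj v w).card := by
        have : s + 1 + t = s + t + 1 := by ring
        rw [this]; omega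
      rcases ih (s + 1) t (by omega) _ h' with ⟨T, hT, hc, hcl⟩ | ⟨T, hT, hc, hcl⟩
      · exact Or.inl ⟨T, hT.trans ((Finset.filter_subset _ _).trans (Finset.erase_subset _ _)),
          hc, hcl⟩
      · refine Or.inr (extend Gᶜ T t (hT.trans (Finset.filter_subset _ _)) ?_ hc hcl)
        intro w hw
        have := Finset.mem_filter.1 (hT hw)
        exact (SimpleGraph.compl_adj _ _ _).2 ⟨(Finset.ne_of_mem_erase this.1).symm, this.2⟩
    · have h' : 2 ^ (s + (t + 1)) ≤ ((S.erase v).filter fun w => G.Adj v w).card := h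
      rcases ih s (t + 1) (by omega) _ h' with ⟨T, hT, hc, hcl⟩ | ⟨T, hT, hc, hcl⟩
      · exact Or.inl (extend G T s (hT.trans (Finset.filter_subset _ _))
          (fun w hw => (Finset.mem_filter.1 (hT hw)).2) hc hcl)
      · exact Or.inr ⟨T, hT.trans ((Finset.filter_subset _ _).trans (Finset.erase_subset _ _)),
          hc, hcl⟩

/-! ### The partite construction -/

/-- The graph on the words `ι → Option V` tagged by parts in `I`: two words of different parts are
adjacent if they are adjacent in `G` at each coordinate where neither is `none`. -/
def partitePower {V : Type*} (G : SimpleGraph V) (I ι : Type*) :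
    SimpleGraph (I × (ι → Option V)) where
  Adj u v := u.1 ≠ v.1 ∧ ∀ i, ∀ x ∈ u.2 i, ∀ y ∈ v.2 i, G.Adj x y
  symm := ⟨fun _ _ h => ⟨h.1.symm, fun i x hx y hy => (h.2 i y hy x hx).symm⟩⟩
  loopless := ⟨fun _ h => h.1 rfl⟩

/-- The partite lemma: a finite partite graph `G` has a finite partite graph `G'` each colouring of
which contains an induced copy of `G`, respecting the parts, whose edges between the parts `a` and
`b` have the same colour. -/
theorem exists_partite_mono_pair {V I κ : Type} [Finite V] [Finite I] [Finite κ]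
    (G : SimpleGraph V) (π : V → I) (hπ : ∀ x y, G.Adj x y → π x ≠ π y) (a b : I) :
    ∃ (V' : Type) (_ : Finite V') (G' : SimpleGraph V') (π' : V' → I),
      (∀ x y, G'.Adj x y → π' x ≠ π' y) ∧
      ∀ c : Sym2 V' → κ, ∃ φ : G ↪g G', (∀ x, π' (φ x) = π x) ∧
        ∃ q, ∀ x y, G.Adj x y → π x = a → π y = b → c s(φ x, φ y) = q := by
  classical
  -- The Hales–Jewett alphabet: a word of edges gives one edge of the power, from the word of
  -- `a`-ends to the word of `b`-ends.
  let E := {e : V × V // G.Adj e.1 e.2 ∧ π e.1 = a ∧ π e.2 = b}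
  obtain ⟨ι, hι, hmono⟩ := Combinatorics.Line.exists_mono_in_high_dimension E κ
  refine ⟨I × (ι → Option V), inferInstance, partitePower G I ι, Prod.fst, fun _ _ h => h.1, ?_⟩
  intro c
  obtain ⟨l, q, hq⟩ := hmono fun w => c s((a, fun i => some (w i).1.1), (b, fun i => some (w i).1.2))
  -- At a fixed letter `e` of the line, parts `a` and `b` collapse to the ends of `e`; other parts
  -- get `none`, which never obstructs adjacency.
  let g : V → ι → Option V := fun x i =>
    (l.idxFun i).elim (some x) fun e =>
      if π x = a then some e.1.1 else if π x = b then some e.1.2 else none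
  -- An active coordinate records `x` itself, so the map is injective and reflects adjacency.
  obtain ⟨i₀, hi₀⟩ := l.proper
  have hg₀ : ∀ x, g x i₀ = some x := fun x => by simp [g, hi₀]
  refine ⟨⟨⟨fun x => (π x, g x), fun x y h => ?_⟩, ?_⟩, fun _ => rfl, q, ?_⟩
  · have := congrFun (Prod.ext_iff.1 h).2 i₀
    simpa [hg₀] using this
  · intro x y
    change (π x ≠ π y ∧ ∀ i, ∀ u ∈ g x i, ∀ v ∈ g y i, G.Adj u v) ↔ G.Adj x y
    refine ⟨fun h => h.2 i₀ x (hg₀ x) y (hg₀ y), fun h => ⟨hπ x y h, fun i u hu v hv => ?_⟩⟩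
    rcases hi : l.idxFun i with _ | e
    · simp only [g, hi, Option.elim_none, Option.mem_def, Option.some.injEq] at hu hv
      rwa [← hu, ← hv]
    · have hab : π x ≠ π y := hπ x y h
      simp only [g, hi, Option.elim_some] at hu hv
      split_ifs at hu hv <;> simp_all <;> subst hu <;> subst hv
      · exact e.2.1
      · exact e.2.1.symm
  · intro x y h hx hy
    have hab : b ≠ a := by rw [← hx, ← hy]; exact (hπ x y h).symm
    have := hq ⟨(x, y), h, hx, hy⟩
    rw [← this]
    change c s((π x, g x), (π y, g y)) = _
    have h1 : g x = fun i => some (l ⟨(x, y), h, hx, hy⟩ i).1.1 := by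
      funext i
      rcases hi : l.idxFun i with _ | e <;> simp [g, hi, hx]
    have h2 : g y = fun i => some (l ⟨(x, y), h, hx, hy⟩ i).1.2 := by
      funext i
      rcases hi : l.idxFun i with _ | e <;> simp [g, hi, hy, hab]
    rw [Prod.mk_inj.2 ⟨hx, h1⟩, Prod.mk_inj.2 ⟨hy, h2⟩]

/-- The partite construction: a finite partite graph `G` has a finite graph `G'` each colouring of
which contains an induced copy of `G` in which the colour of an edge depends only on the parts of
its ends, for the pairs of parts in `S`. -/
theorem exists_partite_mono_pairs {I κ : Type} [Finite I] [Finite κ] (S : Finset (I × I))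
    {V : Type} [Finite V] (G : SimpleGraph V) (π : V → I) (hπ : ∀ x y, G.Adj x y → π x ≠ π y) :
    ∃ (V' : Type) (_ : Finite V') (G' : SimpleGraph V') (π' : V' → I),
      (∀ x y, G'.Adj x y → π' x ≠ π' y) ∧
      ∀ c : Sym2 V' → κ, ∃ φ : G ↪g G', (∀ x, π' (φ x) = π x) ∧
        ∀ p ∈ S, ∃ q, ∀ x y, G.Adj x y → π x = p.1 → π y = p.2 → c s(φ x, φ y) = q := by
  classical
  induction S using Finset.induction_on with
  | empty => exact ⟨V, ‹_›, G, π, hπ, fun c => ⟨SimpleGraph.Embedding.refl, by simp, by simp⟩⟩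
  | insert p S _ ih =>
    obtain ⟨V₁, _, G₁, π₁, hπ₁, h₁⟩ := ih
    obtain ⟨V₂, hV₂, G₂, π₂, hπ₂, h₂⟩ := exists_partite_mono_pair (κ := κ) G₁ π₁ hπ₁ p.1 p.2
    refine ⟨V₂, hV₂, G₂, π₂, hπ₂, fun c => ?_⟩
    obtain ⟨ψ, hψ, q, hq⟩ := h₂ c
    -- Constancy on the pair `p` holds on all of `ψ(G₁)`, so it survives passing to a copy of `G`
    -- inside.
    obtain ⟨φ, hφ, hS⟩ := h₁ fun e => c (e.map ψ)
    refine ⟨ψ.comp φ, fun x => by simp [hψ, hφ], fun p' hp' => ?_⟩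
    rcases Finset.mem_insert.1 hp' with rfl | hp'
    · exact ⟨q, fun x y h hx hy => hq _ _ (φ.map_adj_iff.2 h) ((hφ x).trans hx) ((hφ y).trans hy)⟩
    · exact hS p' hp'

/-- The disjoint union of the copies of `H` spread over the parts in `I` in all injective ways. -/
def spreadCopies {W : Type*} (H : SimpleGraph W) (I : Type*) : SimpleGraph ((W ↪ I) × W) where
  Adj u v := u.1 = v.1 ∧ H.Adj u.2 v.2
  symm := ⟨fun _ _ h => ⟨h.1.symm, h.2.symm⟩⟩
  loopless := ⟨fun _ h => H.loopless.irrefl _ h.2⟩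

/-- The induced Ramsey theorem for two colours. -/
theorem exists_inducedArrows {W : Type} [Finite W] (H : SimpleGraph W) :
    ∃ (V : Type) (_ : Finite V) (G : SimpleGraph V), InducedArrows G H := by
  classical
  have := Fintype.ofFinite W
  let k := Fintype.card W
  let I := Fin (2 ^ (k + k))
  obtain ⟨V, hV, G, π, hπ, hG⟩ := exists_partite_mono_pairs (κ := Fin 2)
    (Finset.univ : Finset (I × I)) (spreadCopies H I) (fun u => u.1 u.2)
    (fun u v h he => h.2.ne (u.1.injective (by rw [he, h.1])))
  refine ⟨V, hV, G, fun c => ?_⟩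
  -- The default `0` is harmless: `c'` is only evaluated at images of edges.
  let c' : Sym2 V → Fin 2 := fun e => if h : e ∈ G.edgeSet then c ⟨e, h⟩ else 0
  obtain ⟨φ, -, hφ⟩ := hG c'
  -- By constancy, one edge of colour 0 between two parts forces 0 on all edges taken in that order
  -- of the parts.
  let Γ : SimpleGraph I := SimpleGraph.fromRel fun a b =>
    ∃ u v, (spreadCopies H I).Adj u v ∧ u.1 u.2 = a ∧ v.1 v.2 = b ∧ c' s(φ u, φ v) = 0
  suffices h : ∃ (σ : W ↪ I) (a : Fin 2), ∀ x y, H.Adj x y → c' s(φ (σ, x), φ (σ, y)) = a by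
    obtain ⟨σ, a, h⟩ := h
    refine ⟨φ.comp ⟨⟨fun x => (σ, x), fun x y h => by simpa using h⟩, and_iff_right rfl⟩,
      a, ?_⟩
    rintro ⟨e, he⟩
    induction e using Sym2.ind with
    | _ x y =>
      rw [SimpleGraph.mem_edgeSet] at he
      rw [← h x y he]
      have hadj : G.Adj (φ (σ, x)) (φ (σ, y)) := φ.map_adj_iff.2 ⟨rfl, he⟩
      simp only [c']
      rw [dif_pos (SimpleGraph.mem_edgeSet _ |>.2 hadj)]
      rfl
  have hcopy : ∀ T : Finset I, T.card = k → ∃ σ : W ↪ I, ∀ x, σ x ∈ T := by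
    intro T hT
    have e : W ≃ T := Fintype.equivOfCardEq (by simp [hT, k])
    exact ⟨e.toEmbedding.trans (Function.Embedding.subtype _), fun x => (e x).2⟩
  rcases exists_ramsey_bound Γ k k Finset.univ (by simp [I]) with
    ⟨T, -, hT, hcl⟩ | ⟨T, -, hT, hcl⟩
  · obtain ⟨σ, hσ⟩ := hcopy T hT
    refine ⟨σ, 0, fun x y h => ?_⟩
    have := hcl (hσ x) (hσ y) (σ.injective.ne h.ne)
    rcases ((SimpleGraph.fromRel_adj _ _ _).1 this).2 with
      ⟨u, v, huv, hu, hv, hc⟩ | ⟨u, v, huv, hu, hv, hc⟩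
    · obtain ⟨q, hq⟩ := hφ (σ x, σ y) (Finset.mem_univ _)
      rw [hq (σ, x) (σ, y) ⟨rfl, h⟩ rfl rfl, ← hq u v huv hu hv, hc]
    · obtain ⟨q, hq⟩ := hφ (σ y, σ x) (Finset.mem_univ _)
      rw [Sym2.eq_swap, hq (σ, y) (σ, x) ⟨rfl, h.symm⟩ rfl rfl, ← hq u v huv hu hv, hc]
  · obtain ⟨σ, hσ⟩ := hcopy T hT
    refine ⟨σ, 1, fun x y h => ?_⟩
    have hne := σ.injective.ne h.ne
    have := hcl (hσ x) (hσ y) hne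
    by_contra hc
    refine ((SimpleGraph.compl_adj _ _ _).1 this).2 ((SimpleGraph.fromRel_adj _ _ _).2
      ⟨hne, Or.inl ⟨(σ, x), (σ, y), ⟨rfl, h⟩, rfl, rfl, ?_⟩⟩)
    omega

/-- Containing an induced monochromatic copy for all colourings passes to induced supergraphs. -/
theorem InducedArrows.mono {V V' W : Type*} {G : SimpleGraph V} {G' : SimpleGraph V'}
    {H : SimpleGraph W} (h : InducedArrows G H) (g : G ↪g G') : InducedArrows G' H := by
  intro c
  obtain ⟨f, a, hf⟩ := h fun e => c (g.mapEdgeSet e)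
  refine ⟨g.comp f, a, fun e => ?_⟩
  rw [← hf e]
  congr 1
  ext1
  exact (Sym2.map_map (g := g) (f := f) e.1).symm

/-- Ensures that the `sInf` is attained and is not the junk value 0. -/
theorem inducedRamseyOrders_nonempty {W : Type} [Finite W] (H : SimpleGraph W) :
    (inducedRamseyOrders H).Nonempty := by
  obtain ⟨V, _, G, hG⟩ := exists_inducedArrows H
  obtain ⟨n, ⟨e⟩⟩ := Finite.exists_equiv_fin V
  exact ⟨n, G.map e.toEmbedding, hG.mono (SimpleGraph.Iso.map e G).toEmbedding⟩

/-! ### Counting random graphs -/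

theorem graphCode_injective {n : ℕ} : Function.Injective (graphCode (n := n)) := by
  classical
  intro G G' h
  have key : ∀ (L : List (Fin n)), (L.flatMap fun i =>
      ((List.finRange n).filter fun j => decide (i < j)).map fun j => decide (G.Adj i j)) =
      (L.flatMap fun i =>
      ((List.finRange n).filter fun j => decide (i < j)).map fun j => decide (G'.Adj i j)) →
      ∀ i ∈ L, ∀ j, i < j → (G.Adj i j ↔ G'.Adj i j) := by
    intro L
    induction L with
    | nil => simp
    | cons a L ih =>
      intro hL i hi j hij
      rw [List.flatMap_cons, List.flatMap_cons] at hL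
      -- The block of a vertex has the same length for both graphs.
      obtain ⟨h1, h2⟩ := List.append_inj hL (by simp)
      rcases List.mem_cons.1 hi with rfl | hi
      · have := List.map_inj_left.1 h1 j (by simpa using hij)
        simpa using this
      · exact ih h2 i hi j hij
  have hlt : ∀ i j, i < j → (G.Adj i j ↔ G'.Adj i j) := fun i j =>
    key (List.finRange n) (by unfold graphCode at h; convert h) i (List.mem_finRange i) j
  ext i j
  rcases lt_trichotomy i j with hij | rfl | hij
  · exact hlt i j hij
  · simp
  · rw [G.adj_comm, G'.adj_comm]; exact hlt j i hij

/-- Among `2 ^ m` strings there is one of complexity at least `m`. -/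
theorem exists_le_condComplexity {U : List Bool × ℕ →. List Bool} (hU : IsReferenceMachine U)
    {A : Type*} [Fintype A] {f : A → List Bool} (hf : Function.Injective f) (n m : ℕ)
    (hA : 2 ^ m ≤ Fintype.card A) : ∃ a, m ≤ condComplexity U (f a) n := by
  by_contra! hlt
  choose p hp hlen using fun a => exists_program hU (f a) n
  -- Shortest programs determine their outputs, and only `2 ^ m - 1` strings are shorter than `m`.
  let g : A → Σ i : Fin m, List.Vector Bool i := fun a =>
    ⟨⟨(p a).length, by rw [hlen]; exact hlt a⟩, ⟨p a, rfl⟩⟩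
  have hg : Function.Injective g := by
    intro a b hab
    have hpab : p a = p b := congrArg (fun s : Σ i : Fin m, List.Vector Bool i => s.2.1) hab
    exact hf (Part.mem_unique (hp a) (hpab ▸ hp b))
  have h1 := Fintype.card_le_of_injective g hg
  rw [Fintype.card_sigma] at h1
  simp only [card_vector, Fintype.card_bool] at h1
  rw [Fin.sum_univ_eq_sum_range (fun i => 2 ^ i)] at h1
  have h2 := Nat.geomSum_lt (m := 2) (n := m) (s := Finset.range m) le_rfl (by simp)
  omega

/-- The graph on `Fin (m + n)` which is the disjoint union of `K` and `G`. -/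
def finDisjointUnion {m n : ℕ} (K : SimpleGraph (Fin m)) (G : SimpleGraph (Fin n)) :
    SimpleGraph (Fin (m + n)) :=
  (K ⊕g G).map finSumFinEquiv.toEmbedding

theorem finDisjointUnion_injective {m n : ℕ} (G : SimpleGraph (Fin n)) :
    Function.Injective fun K : SimpleGraph (Fin m) => finDisjointUnion K G := by
  intro K K' h
  have := SimpleGraph.map_injective finSumFinEquiv.toEmbedding h
  ext x y
  have h' := congrArg (fun L : SimpleGraph (Fin m ⊕ Fin n) => L.Adj (.inl x) (.inl y)) this
  simpa using h'

theorem two_pow_choose_two_le_card_simpleGraph (m : ℕ) :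
    2 ^ m.choose 2 ≤ Nat.card (SimpleGraph (Fin m)) := by
  classical
  let f : Set (⊤ : SimpleGraph (Fin m)).edgeSet → SimpleGraph (Fin m) := fun s =>
    SimpleGraph.fromEdgeSet (Subtype.val '' s)
  have hf : Function.Injective f := by
    intro s t hst
    have h := congrArg SimpleGraph.edgeSet hst
    have hdis : ∀ s : Set (⊤ : SimpleGraph (Fin m)).edgeSet,
        (f s).edgeSet = Subtype.val '' s := by
      intro s
      rw [SimpleGraph.edgeSet_fromEdgeSet, sdiff_eq_left, Set.disjoint_left]
      rintro _ ⟨e, -, rfl⟩ he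
      exact SimpleGraph.not_isDiag_of_mem_edgeSet _ e.2 he
    rw [hdis, hdis] at h
    exact Subtype.val_injective.image_injective h
  have h := Nat.card_le_card_of_injective f hf
  rwa [Nat.card_eq_fintype_card, Fintype.card_set, ← SimpleGraph.edgeFinset_card,
    SimpleGraph.card_edgeFinset_top_eq_card_choose_two, Fintype.card_fin] at h

/-- Some disjoint union of a graph on `m` vertices with a given graph on `n` vertices has a code of
complexity at least `m.choose 2`. -/
theorem exists_le_condComplexity_finDisjointUnion {U : List Bool × ℕ →. List Bool}
    (hU : IsReferenceMachine U) (m : ℕ) {n : ℕ} (G : SimpleGraph (Fin n)) :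
    ∃ K : SimpleGraph (Fin m),
      m.choose 2 ≤ condComplexity U (graphCode (finDisjointUnion K G)) (m + n) := by
  have := Fintype.ofFinite (SimpleGraph (Fin m))
  refine exists_le_condComplexity hU
    (graphCode_injective.comp (finDisjointUnion_injective G)) (m + n) _ ?_
  rw [← Nat.card_eq_fintype_card]
  exact two_pow_choose_two_le_card_simpleGraph m

theorem mainTheorem1
    (U : List Bool × ℕ →. List Bool) (hU : IsReferenceMachine U)
    (F : (k : ℕ) → Set (SimpleGraph (Fin k))) (hF : SizeConstructible F)
    (k d : ℕ) (H : SimpleGraph (Fin k)) [DecidableRel H.Adj] (hH : H ∈ F k)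
    (hd : H.maxDegree ≤ d)
    (n₁ n₂ : ℕ) (hn₁ : n₁ = ⌊(2 : ℝ) ^ (((k : ℝ) - 1) / 2) - 1⌋₊)
    (hn₂ : n₂ = inducedRamseyNumber H)
    (δ : ℕ → ℝ) (hδ : (n₁ * n₂ + n₂.choose 2 : ℝ) ≤ δ (n₁ + n₂)) :
    (randomInducedRamseyOrders U δ H).Nonempty ∧
      (randomInducedRamseyNumber U δ H : ℝ) <
        (2 : ℝ) ^ (((k : ℝ) - 1) / 2) + (inducedRamseyNumber H : ℝ) := by
  obtain ⟨G, hG⟩ : n₂ ∈ inducedRamseyOrders H := by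
    rw [hn₂]; exact Nat.sInf_mem (inducedRamseyOrders_nonempty H)
  obtain ⟨K, hK⟩ := exists_le_condComplexity_finDisjointUnion hU n₁ G
  have hmem : n₁ + n₂ ∈ randomInducedRamseyOrders U δ H := by
    refine ⟨finDisjointUnion K G, ?_, hG.mono ((SimpleGraph.Iso.map finSumFinEquiv
      (K ⊕g G)).toEmbedding.comp SimpleGraph.Embedding.sumInr)⟩
    have hK' : (n₁.choose 2 : ℝ) ≤
        (condComplexity U (graphCode (finDisjointUnion K G)) (n₁ + n₂) : ℝ) := by
      exact_mod_cast hK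
    -- The last two terms are exactly the deficiency that `hδ` allows.
    have hsplit : ((n₁ + n₂).choose 2 : ℝ) = n₁.choose 2 + n₁ * n₂ + n₂.choose 2 := by
      simp only [Nat.cast_choose_two, Nat.cast_add]
      ring
    unfold IsRandomGraph
    linarith
  refine ⟨⟨_, hmem⟩, ?_⟩
  have hpos : (0 : ℝ) < (2 : ℝ) ^ (((k : ℝ) - 1) / 2) := Real.rpow_pos_of_pos two_pos _
  have hn₁lt : (n₁ : ℝ) < (2 : ℝ) ^ (((k : ℝ) - 1) / 2) := by
    -- The `- 1` under the floor gives strictness; when the floored quantity is negative (`k = 0`),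
    -- `n₁` is 0.
    rcases le_total 0 ((2 : ℝ) ^ (((k : ℝ) - 1) / 2) - 1) with h | h
    · have := Nat.floor_le h
      rw [← hn₁] at this
      linarith
    · rwa [hn₁, Nat.floor_of_nonpos h, Nat.cast_zero]
  have hle : (randomInducedRamseyNumber U δ H : ℝ) ≤ n₁ + n₂ := by
    exact_mod_cast Nat.sInf_le hmem
  rw [← hn₂]
  linarith
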